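/- **Theorem (Law of large numbers).** Let $\mathbb T_2=(\mathbb R/L\mathbb Z)^2$, $L>0$, be the two-dimensional flat torus, with normalized Lebesgue measure $\ell$, and let $(e_k)_{k\ge1}$ be a real orthonormal basis (trigonometric functions) of the zero-average functions of $L^2(\ell)$ made of eigenfunctions of $-\Delta$, with eigenvalues $(\lambda_k)_{k\ge1}$. For $m\in\mathbb R$ and $\epsilon>0$ let $$G_{m,\epsilon}(x,y)=\sum_{k\ge1}\lambda_k^{-m/2}e^{-\epsilon\lambda_k}e_k(x)e_k(y),\qquad H_N^\epsilon(\gamma,X)=\frac12\sum_{j\ne k}\gamma_j\gamma_kG_{m,\epsilon}(X_j,X_k).$$ Let $\nu$ be a probability measure on $\mathbb R$ with compact support, let $\beta>0$, and let $$\mu^N_{\beta,\epsilon}(d\gamma,dX)=\frac1{Z^N_{\beta,\epsilon}}\,e^{-\frac{\beta}{N}H_N^\epsilon(\gamma,X)}\,d\ell^{\otimes N}\,d\nu^{\otimes N},$$ where $Z^N_{\beta,\epsilon}$ is the normalization factor. There is a constant $C>0$, depending only on $L$, $\nu$ and $\beta$, such that the following holds for every $m<2$ and every sequence $\epsilon(N)>0$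 with $\epsilon(N)\to0$ as $N\to\infty$ and $$\epsilon(N)\ge C(\log N)^{-\frac{2}{2-m}}\qquad\text{for all }N\ge2 .$$ The measures $\mu^N_{\beta,\epsilon(N)}$ are well-defined probability measures. If $(\gamma_1,X_1),\dots,(\gamma_N,X_N)$ has law $\mu^N_{\beta,\epsilon(N)}$, then the empirical measure $$\eta_N=\frac1N\sum_{j=1}^N\delta_{(\gamma_j,X_j)}$$ converges weakly to $\nu\otimes\ell$ in probability as $N\to\infty$: for every neighbourhood $U$ of $\nu\otimes\ell$ in the space of probability measures on $\mathbb R\times\mathbb T_2$ with the topology of weak convergence, the probability that $\eta_N\notin U$ tends to $0$. Consequently, the empirical pseudo-vorticity $\theta_N=\frac1N\sum_{j=1}^N\gamma_j\delta_{X_j}$ converges weakly in probability to $\nu(\gamma)\,\ell$, where $\nu(\gamma)=\int\gamma\,\nu(d\gamma)$: for every continuous $\varphi:\mathbb T_2\to\mathbb R$, $\int\varphi\,d\theta_N\to\nu(\gamma)\int\varphi\,d\ell$ in probability. -/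

import Mathlib

open Filter Topology MeasureTheory
open scoped ENNReal

namespace PointVortex

noncomputable section

/-- The two dimensional flat torus `(ℝ / L ℤ)²` of period `L`. -/
abbrev Torus (L : ℝ) : Type := Fin 2 → AddCircle L

/-- The normalized Lebesgue measure `ℓ` on the torus (a probability measure). -/
def ell (L : ℝ) [Fact (0 < L)] : Measure (Torus L) :=
  Measure.pi fun _ => AddCircle.haarAddCircle

instance (L : ℝ) [Fact (0 < L)] : IsProbabilityMeasure (ell L) := by
  unfold ell; infer_instance

/-- The nonzero frequencies `n ∈ ℤ² \ {0}`: the constants are excluded because of the condition of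
zero spatial average. -/
abbrev Freq : Type := {n : Fin 2 → ℤ // n ≠ 0}

/-- The eigenvalue `λ_n = (2π/L)² |n|²` of `-Δ` on the torus of period `L`. -/
def eigenvalue (L : ℝ) (n : Freq) : ℝ :=
  (2 * Real.pi / L) ^ 2 * ((n.1 0 : ℝ) ^ 2 + (n.1 1 : ℝ) ^ 2)

/-- The character `x ↦ exp (2 π i n·x / L)` of the torus. -/
def character (L : ℝ) (n : Fin 2 → ℤ) (x : Torus L) : ℂ :=
  ∏ i, fourier (n i) (x i)

open Classical in
/-- The real trigonometric orthonormal basis (in `L²(ℓ)`, zero average) of eigenfunctions of `-Δ`: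
one of `n`, `-n` carries `√2 cos (2π n·x/L)`, the other one carries `√2 sin (2π n·x/L)`.
The function `eigenfunction L n` has eigenvalue `eigenvalue L n`. -/
def eigenfunction (L : ℝ) (n : Freq) (x : Torus L) : ℝ :=
  if 0 < n.1 0 ∨ (n.1 0 = 0 ∧ 0 < n.1 1) then √2 * (character L n.1 x).re
  else √2 * (character L n.1 x).im

/-- The regularized Green function
`G_{m,ε}(x,y) = ∑_k λ_k^{-m/2} exp (-ε λ_k) e_k(x) e_k(y)` of `(-Δ)^{m/2}`, for `ε > 0`
(the series is then absolutely convergent, so that the order of summation is irrelevant). -/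
def greenReg (L m ε : ℝ) (x y : Torus L) : ℝ :=
  ∑' n : Freq, eigenvalue L n ^ (-(m / 2)) * Real.exp (-ε * eigenvalue L n) *
    eigenfunction L n x * eigenfunction L n y

/-- A configuration of `N` vortices: the pairs `(γ_j, X_j)` of intensity and position. -/
abbrev Config (L : ℝ) (N : ℕ) : Type := Fin N → ℝ × Torus L

/-- The regularized Hamiltonian
`H_N^ε(γ, X) = (1/2) ∑_{j ≠ k} γ_j γ_k G_{m,ε}(X_j, X_k)`. -/
def hamiltonian (L m ε : ℝ) {N : ℕ} (ω : Config L N) : ℝ :=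
  (1 / 2) * ∑ j, ∑ k ∈ Finset.univ.erase j,
    (ω j).1 * (ω k).1 * greenReg L m ε (ω j).2 (ω k).2

/-- The equilibrium measure
`μ^N_{β,ε} = (1/Z) exp (-(β/N) H_N^ε) dℓ^{⊗N} dν^{⊗N}`, where `Z = Z^N_{β,ε}` is the integral of
`exp (-(β/N) H_N^ε)` with respect to `(ν ⊗ ℓ)^{⊗N}`. -/
def gibbs (L : ℝ) [Fact (0 < L)] (ν : Measure ℝ) (m β ε : ℝ) (N : ℕ) : Measure (Config L N) :=
  (Measure.pi fun _ : Fin N => ν.prod (ell L)).tilted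
    fun ω => -(β / N) * hamiltonian L m ε ω

/-- The empirical measure `η_N = (1/N) ∑_j δ_{(γ_j, X_j)}` of intensities and positions. -/
def empiricalMeasure {L : ℝ} [Fact (0 < L)] {N : ℕ} [NeZero N] (ω : Config L N) :
    ProbabilityMeasure (ℝ × Torus L) :=
  ⟨(N : ℝ≥0∞)⁻¹ • ∑ j, Measure.dirac (ω j), ⟨by
    simp [ENNReal.inv_mul_cancel (Nat.cast_ne_zero.2 (NeZero.ne N)) (ENNReal.natCast_ne_top N)]⟩⟩

/-- The empirical pseudo-vorticity `θ_N = (1/N) ∑_j γ_j δ_{X_j}`, a signed measure. -/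
def pseudoVorticity {L : ℝ} [Fact (0 < L)] {N : ℕ} (ω : Config L N) : SignedMeasure (Torus L) :=
  (N : ℝ)⁻¹ • ∑ j, VectorMeasure.dirac (ω j).2 (ω j).1

/-- The measure `ν ⊗ ℓ` as a point of the space of probability measures on `ℝ × 𝕋₂`. -/
def limitMeasure (L : ℝ) [Fact (0 < L)] (ν : Measure ℝ) [IsProbabilityMeasure ν] :
    ProbabilityMeasure (ℝ × Torus L) :=
  ⟨ν.prod (ell L), inferInstance⟩

/-- Random elements `X n`, defined on possibly different spaces `(Ω n, P n)`, converge in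
probability to the deterministic point `a` of the topological space `E`. -/
def ConvergesInProbability {Ω : ℕ → Type*} {mΩ : ∀ n, MeasurableSpace (Ω n)}
    (P : ∀ n, Measure (Ω n)) {E : Type*} [TopologicalSpace E] (X : ∀ n, Ω n → E) (a : E) : Prop :=
  ∀ U ∈ 𝓝 a, Tendsto (fun n => P n {ω | X n ω ∉ U}) atTop (𝓝 0)

end

end PointVortex

/-! The Gibbs measure is compared with the free measure, under which the vortices are independent.
The Green function is positive semidefinite, so the Hamiltonian is bounded below by minus its
diagonal self-energy (`hamiltonian_ge`), and the Gibbs exponent is at most `β K²` times the sum of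
the weights. The Hamiltonian has zero mean under the free measure, so `exp t ≥ 1 + t` gives a
partition function at least `1`. Together these bound the Gibbs density uniformly (`gibbs_le`).

Under the free measure, Hoeffding's inequality makes a deviation of an empirical average
exponentially small in `N` (`freeMeasure_average_le`). The logarithmic lower bound on `ε` keeps the
sum of weights below a power of `log N`, hence `o(N)` (`tendsto_tsum_weight_div`), so the density
bound cannot offset this decay. Weak convergence then follows by testing bounded continuous
functions. -/

namespace PointVortex

noncomputable section

/-! ### Spectral weights and their sum -/

/-- The weight `λ_n^{-m/2} exp (-ε λ_n)` of the mode `n` in the regularized Green function. -/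
def weight (L m ε : ℝ) (n : Freq) : ℝ :=
  eigenvalue L n ^ (-(m / 2)) * Real.exp (-ε * eigenvalue L n)

lemma norm_freq_pos (n : Freq) : 0 < ‖n.1‖ := norm_pos_iff.2 n.2

lemma norm_sq_le_eigenvalue (L : ℝ) (n : Freq) :
    (2 * Real.pi / L) ^ 2 * ‖n.1‖ ^ 2 ≤ eigenvalue L n := by
  unfold eigenvalue
  gcongr
  rw [← Real.le_sqrt (norm_nonneg _) (by positivity)]
  refine (pi_norm_le_iff_of_nonneg (Real.sqrt_nonneg _)).2 fun i => ?_
  rw [Int.norm_eq_abs]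
  apply Real.abs_le_sqrt
  fin_cases i <;> simp <;> positivity

lemma eigenvalue_pos {L : ℝ} (hL : 0 < L) (n : Freq) : 0 < eigenvalue L n := by
  have := norm_freq_pos n
  have := Real.pi_pos
  exact lt_of_lt_of_le (by positivity) (norm_sq_le_eigenvalue L n)

lemma weight_nonneg {L : ℝ} (hL : 0 < L) (m ε : ℝ) (n : Freq) : 0 ≤ weight L m ε n :=
  mul_nonneg (Real.rpow_nonneg (eigenvalue_pos hL n).le _) (Real.exp_pos _).le

lemma summable_eigenvalue_sq_inv {L : ℝ} (hL : 0 < L) :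
    Summable fun n : Freq => (eigenvalue L n ^ 2)⁻¹ := by
  have h := (EisensteinSeries.summable_one_div_norm_rpow (k := 4) (by norm_num)).subtype
    {n : Fin 2 → ℤ | n ≠ 0}
  refine (h.mul_left (((2 * Real.pi / L) ^ 4)⁻¹)).of_nonneg_of_le (fun n => by positivity)
    fun n => ?_
  have hn := norm_freq_pos n
  have hpi := Real.pi_pos
  have e : ‖n.1‖ ^ (-4 : ℝ) = (‖n.1‖ ^ 4)⁻¹ := by
    rw [Real.rpow_neg hn.le]; norm_cast
  simp only [Function.comp_apply]
  rw [e, ← mul_inv]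
  apply inv_anti₀ (by positivity)
  calc (2 * Real.pi / L) ^ 4 * ‖n.1‖ ^ 4 = ((2 * Real.pi / L) ^ 2 * ‖n.1‖ ^ 2) ^ 2 := by ring
    _ ≤ _ := by gcongr; exact norm_sq_le_eigenvalue L n

/-- This is `t ≤ exp t` at `t = ε x / a`, raised to the power `a`. -/
lemma rpow_mul_exp_neg_le {a x ε : ℝ} (ha : 0 < a) (hx : 0 < x) (hε : 0 < ε) :
    x ^ a * Real.exp (-ε * x) ≤ a ^ a * ε ^ (-a) := by
  have h : ε * x / a ≤ Real.exp (ε * x / a) := by linarith [Real.add_one_le_exp (ε * x / a)]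
  have h2 := Real.rpow_le_rpow (by positivity) h ha.le
  rw [← Real.exp_mul, div_mul_cancel₀ _ ha.ne', Real.div_rpow (by positivity) ha.le,
    Real.mul_rpow hε.le hx.le, div_le_iff₀ (by positivity)] at h2
  rw [neg_mul, Real.exp_neg, Real.rpow_neg hε.le, ← div_eq_mul_inv, ← div_eq_mul_inv,
    div_le_div_iff₀ (Real.exp_pos _) (by positivity)]
  linarith

/-- The factor `λ⁻²` is set aside for summability over the frequencies and the exponential absorbs
the rest. The power of `ε` is not optimal, but only some power of `log N` is needed in the end. -/
lemma weight_le {L m ε : ℝ} (hL : 0 < L) (hm : m < 2) (hε : 0 < ε) (n : Freq) :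
    weight L m ε n ≤
      (2 - m / 2) ^ (2 - m / 2) * ε ^ (-(2 - m / 2)) * (eigenvalue L n ^ 2)⁻¹ := by
  have hl := eigenvalue_pos hL n
  have h := rpow_mul_exp_neg_le (a := 2 - m / 2) (by linarith) hl hε
  have e : eigenvalue L n ^ (-(m / 2)) = eigenvalue L n ^ (2 - m / 2) * (eigenvalue L n ^ 2)⁻¹ := by
    rw [← Real.rpow_natCast, ← Real.rpow_neg hl.le, ← Real.rpow_add hl]
    congr 1; push_cast; ring
  rw [weight, e, mul_right_comm]
  gcongr

lemma summable_weight {L m ε : ℝ} (hL : 0 < L) (hm : m < 2) (hε : 0 < ε) :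
    Summable (weight L m ε) :=
  ((summable_eigenvalue_sq_inv hL).mul_left _).of_nonneg_of_le (weight_nonneg hL m ε)
    (weight_le hL hm hε)

lemma tsum_weight_le {L m ε : ℝ} (hL : 0 < L) (hm : m < 2) (hε : 0 < ε) :
    ∑' n, weight L m ε n ≤ (2 - m / 2) ^ (2 - m / 2) * ε ^ (-(2 - m / 2)) *
      ∑' n : Freq, (eigenvalue L n ^ 2)⁻¹ := by
  rw [← tsum_mul_left]
  exact (summable_weight hL hm hε).tsum_le_tsum (weight_le hL hm hε)
    ((summable_eigenvalue_sq_inv hL).mul_left _)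

/-! ### Eigenfunctions: bounds and zero average -/

lemma continuous_character (L : ℝ) (n : Fin 2 → ℤ) : Continuous (character L n) := by
  unfold character
  fun_prop

lemma norm_character (L : ℝ) (n : Fin 2 → ℤ) (x : Torus L) : ‖character L n x‖ = 1 := by
  rw [character, norm_prod]
  exact Finset.prod_eq_one fun i _ => Circle.norm_coe _

lemma integral_fourier_eq_zero (L : ℝ) [Fact (0 < L)] {n : ℤ} (hn : n ≠ 0) :
    ∫ x : AddCircle L, fourier n x ∂AddCircle.haarAddCircle = 0 :=
  integral_eq_zero_of_add_right_eq_neg (fourier_add_half_inv_index hn Fact.out)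

lemma integral_character (L : ℝ) [Fact (0 < L)] (n : Freq) :
    ∫ x, character L n.1 x ∂ell L = 0 := by
  obtain ⟨i, hi⟩ := Function.ne_iff.1 n.2
  unfold character ell
  rw [integral_fintype_prod_eq_prod (f := fun i (x : AddCircle L) => (fourier (n.1 i) x : ℂ))]
  exact Finset.prod_eq_zero (Finset.mem_univ i) (integral_fourier_eq_zero L hi)

lemma continuous_eigenfunction (L : ℝ) (n : Freq) : Continuous (eigenfunction L n) := by
  have := continuous_character L n.1
  unfold eigenfunction
  split_ifs <;> fun_prop

lemma abs_eigenfunction_le (L : ℝ) (n : Freq) (x : Torus L) : |eigenfunction L n x| ≤ √2 := by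
  have h := norm_character L n.1 x
  have h1 := Complex.abs_re_le_norm (character L n.1 x)
  have h2 := Complex.abs_im_le_norm (character L n.1 x)
  rw [h] at h1 h2
  unfold eigenfunction
  split_ifs <;> rw [abs_mul, abs_of_nonneg (Real.sqrt_nonneg 2)] <;>
    exact mul_le_of_le_one_right (Real.sqrt_nonneg 2) (by assumption)

lemma integral_eigenfunction (L : ℝ) [Fact (0 < L)] (n : Freq) :
    ∫ x, eigenfunction L n x ∂ell L = 0 := by
  have hi : Integrable (character L n.1) (ell L) :=
    .of_bound (continuous_character L n.1).aestronglyMeasurable 1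
      (ae_of_all _ fun x => (norm_character L n.1 x).le)
  have h0 := integral_character L n
  have hre : ∫ x, (character L n.1 x).re ∂ell L = 0 := by
    simpa [h0] using (integral_re (𝕜 := ℂ) hi)
  have him : ∫ x, (character L n.1 x).im ∂ell L = 0 := by
    simpa [h0] using (integral_im (𝕜 := ℂ) hi)
  unfold eigenfunction
  split_ifs <;> simp [integral_const_mul, hre, him]

lemma abs_eigenfunction_mul_le (L : ℝ) (n : Freq) (x y : Torus L) :
    |eigenfunction L n x * eigenfunction L n y| ≤ 2 := by
  rw [abs_mul]
  calc _ ≤ √2 * √2 := by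
        gcongr <;> exact abs_eigenfunction_le L n _
    _ = 2 := by norm_num

/-! ### Regularized Green function and lower bound on the Hamiltonian -/

lemma greenReg_eq (L m ε : ℝ) (x y : Torus L) :
    greenReg L m ε x y =
      ∑' n : Freq, weight L m ε n * (eigenfunction L n x * eigenfunction L n y) :=
  tsum_congr fun n => by rw [weight, mul_assoc]

lemma norm_greenReg_term_le {L : ℝ} (hL : 0 < L) (m ε : ℝ) (n : Freq) (x y : Torus L) :
    ‖weight L m ε n * (eigenfunction L n x * eigenfunction L n y)‖ ≤ weight L m ε n * 2 := by
  have := weight_nonneg hL m ε n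
  rw [norm_mul, Real.norm_of_nonneg this]
  gcongr
  exact abs_eigenfunction_mul_le L n x y

lemma hasSum_greenReg {L m ε : ℝ} (hL : 0 < L) (hm : m < 2) (hε : 0 < ε) (x y : Torus L) :
    HasSum (fun n : Freq => weight L m ε n * (eigenfunction L n x * eigenfunction L n y))
      (greenReg L m ε x y) := by
  rw [greenReg_eq]
  exact (((summable_weight hL hm hε).mul_right 2).of_norm_bounded
    fun n => norm_greenReg_term_le hL m ε n x y).hasSum

lemma continuous_greenReg {L m ε : ℝ} (hL : 0 < L) (hm : m < 2) (hε : 0 < ε) :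
    Continuous fun p : Torus L × Torus L => greenReg L m ε p.1 p.2 := by
  simp_rw [greenReg_eq]
  refine continuous_tsum (fun n => ?_) ((summable_weight hL hm hε).mul_right 2)
    fun n p => norm_greenReg_term_le hL m ε n p.1 p.2
  have := continuous_eigenfunction L n
  fun_prop

lemma abs_greenReg_le {L m ε : ℝ} (hL : 0 < L) (hm : m < 2) (hε : 0 < ε) (x y : Torus L) :
    |greenReg L m ε x y| ≤ 2 * ∑' n, weight L m ε n := by
  rw [mul_comm, ← tsum_mul_right, greenReg_eq]
  exact tsum_of_norm_bounded ((summable_weight hL hm hε).mul_right 2).hasSum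
    fun n => norm_greenReg_term_le hL m ε n x y

/-- The regularized Green function is positive semidefinite. -/
lemma greenReg_posSemidef {L m ε : ℝ} (hL : 0 < L) (hm : m < 2) (hε : 0 < ε) {N : ℕ}
    (ω : Config L N) :
    0 ≤ ∑ j, ∑ k, (ω j).1 * (ω k).1 * greenReg L m ε (ω j).2 (ω k).2 := by
  have h := hasSum_sum (s := Finset.univ) fun j _ => hasSum_sum (s := Finset.univ) fun k _ =>
    (hasSum_greenReg hL hm hε (ω j).2 (ω k).2).mul_left ((ω j).1 * (ω k).1)
  refine h.nonneg fun n => ?_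
  -- Each mode contributes a nonnegative weight times a perfect square.
  have e : ∑ j, ∑ k, (ω j).1 * (ω k).1 *
      (weight L m ε n * (eigenfunction L n (ω j).2 * eigenfunction L n (ω k).2)) =
      weight L m ε n * (∑ j, (ω j).1 * eigenfunction L n (ω j).2) ^ 2 := by
    rw [sq, Finset.sum_mul_sum, Finset.mul_sum]
    refine Finset.sum_congr rfl fun j _ => ?_
    rw [Finset.mul_sum]
    exact Finset.sum_congr rfl fun k _ => by ring
  rw [e]
  exact mul_nonneg (weight_nonneg hL m ε n) (sq_nonneg _)

/-- Restoring the diagonal `j = k` gives a nonnegative quadratic form, so only the diagonal can be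
lost. The factor `1/2` cancels the `2` from `|e_n(x) e_n(y)| ≤ 2`. -/
lemma hamiltonian_ge {L m ε : ℝ} (hL : 0 < L) (hm : m < 2) (hε : 0 < ε) {N : ℕ} {K : ℝ}
    {ω : Config L N} (hω : ∀ j, |(ω j).1| ≤ K) :
    -(N * (K ^ 2 * ∑' n, weight L m ε n)) ≤ hamiltonian L m ε ω := by
  have h0 := greenReg_posSemidef hL hm hε ω
  have h1 (j : Fin N) : (ω j).1 * (ω j).1 * greenReg L m ε (ω j).2 (ω j).2 ≤
      K ^ 2 * (2 * ∑' n, weight L m ε n) := by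
    have := (le_abs_self _).trans (abs_greenReg_le hL hm hε (ω j).2 (ω j).2)
    have h2 : (ω j).1 * (ω j).1 ≤ K ^ 2 := by
      rw [← sq, ← sq_abs]
      exact pow_le_pow_left₀ (abs_nonneg _) (hω j) 2
    calc _ ≤ (ω j).1 * (ω j).1 * (2 * ∑' n, weight L m ε n) :=
          mul_le_mul_of_nonneg_left this (mul_self_nonneg _)
      _ ≤ _ := mul_le_mul_of_nonneg_right h2
          ((abs_nonneg _).trans (abs_greenReg_le hL hm hε (ω j).2 (ω j).2))
  have h2 : ∑ j, ∑ k ∈ Finset.univ.erase j,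
      (ω j).1 * (ω k).1 * greenReg L m ε (ω j).2 (ω k).2 =
      ∑ j, ∑ k, (ω j).1 * (ω k).1 * greenReg L m ε (ω j).2 (ω k).2 -
      ∑ j, (ω j).1 * (ω j).1 * greenReg L m ε (ω j).2 (ω j).2 := by
    rw [← Finset.sum_sub_distrib]
    exact Finset.sum_congr rfl fun j _ => Finset.sum_erase_eq_sub (Finset.mem_univ j)
  have h3 := Finset.sum_le_sum fun j (_ : j ∈ Finset.univ) => h1 j
  simp only [Finset.sum_const, Finset.card_univ, Fintype.card_fin, nsmul_eq_mul] at h3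
  rw [hamiltonian, h2]
  linarith

lemma measurable_hamiltonian_term {L m ε : ℝ} (hL : 0 < L) (hm : m < 2) (hε : 0 < ε) {N : ℕ}
    (j k : Fin N) :
    Measurable fun ω : Config L N =>
      (ω j).1 * (ω k).1 * greenReg L m ε (ω j).2 (ω k).2 := by
  have := (continuous_greenReg hL hm hε).measurable
  have h2 : Measurable fun ω : Config L N => ((ω j).2, (ω k).2) := by fun_prop
  have h3 := this.comp h2
  simp only [Function.comp_def] at h3
  fun_prop

lemma measurable_hamiltonian {L m ε : ℝ} (hL : 0 < L) (hm : m < 2) (hε : 0 < ε) (N : ℕ) :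
    Measurable fun ω : Config L N => hamiltonian L m ε ω :=
  (Finset.measurable_sum _ fun j _ => Finset.measurable_sum _ fun k _ =>
    measurable_hamiltonian_term hL hm hε j k).const_mul _

/-! ### The free measure and the mean of the Hamiltonian -/

/-- The law of `N` independent vortices, each of law `ν ⊗ ℓ`. -/
def freeMeasure (L : ℝ) [Fact (0 < L)] (ν : Measure ℝ) (N : ℕ) : Measure (Config L N) :=
  Measure.pi fun _ : Fin N => ν.prod (ell L)

variable {L : ℝ} [hL : Fact (0 < L)] {ν : Measure ℝ} [IsProbabilityMeasure ν]

instance (N : ℕ) : IsProbabilityMeasure (freeMeasure L ν N) := by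
  unfold freeMeasure; infer_instance

omit [IsProbabilityMeasure ν] in
lemma ae_abs_fst_le {K : ℝ} (hK : ∀ᵐ γ ∂ν, |γ| ≤ K) :
    ∀ᵐ p ∂ν.prod (ell L), |p.1| ≤ K :=
  Measure.quasiMeasurePreserving_fst.ae hK

lemma ae_forall_eval {p : ℝ × Torus L → Prop} (hp : ∀ᵐ z ∂ν.prod (ell L), p z) (N : ℕ) :
    ∀ᵐ ω ∂freeMeasure L ν N, ∀ j, p (ω j) :=
  ae_all_iff.2 fun j =>
    (Measure.quasiMeasurePreserving_eval (fun _ : Fin N => ν.prod (ell L)) j).ae hp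

lemma integral_free_eval {f : ℝ × Torus L → ℝ} (hf : AEStronglyMeasurable f (ν.prod (ell L)))
    {N : ℕ} (j : Fin N) :
    ∫ ω, f (ω j) ∂freeMeasure L ν N = ∫ p, f p ∂ν.prod (ell L) := by
  have h := measurePreserving_eval (fun _ : Fin N => ν.prod (ell L)) j
  rw [← h.map_eq] at hf
  have := integral_map (h.measurable.aemeasurable) hf
  rw [h.map_eq] at this
  exact this.symm

lemma integral_fst_mul_eigenfunction (n : Freq) :
    ∫ p, p.1 * eigenfunction L n p.2 ∂ν.prod (ell L) = 0 := by
  rw [integral_prod_mul (fun γ : ℝ => γ) (eigenfunction L n), integral_eigenfunction, mul_zero]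

lemma integral_mode_pair (n : Freq) {N : ℕ} {j k : Fin N} (hjk : j ≠ k) :
    ∫ ω, (ω j).1 * eigenfunction L n (ω j).2 * ((ω k).1 * eigenfunction L n (ω k).2)
      ∂freeMeasure L ν N = 0 := by
  have hm : Measurable fun p : ℝ × Torus L => p.1 * eigenfunction L n p.2 := by
    have := (continuous_eigenfunction L n).measurable
    fun_prop
  have hind := (ProbabilityTheory.iIndepFun_pi (μ := fun _ : Fin N => ν.prod (ell L))
    (X := fun _ p => p.1 * eigenfunction L n p.2) fun _ => hm.aemeasurable).indepFun hjk
  have h := hind.integral_fun_mul_eq_mul_integral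
    (hm.comp (measurable_pi_apply j)).aestronglyMeasurable
    (hm.comp (measurable_pi_apply k)).aestronglyMeasurable
  refine h.trans ?_
  have h2 := integral_free_eval (ν := ν) hm.aestronglyMeasurable j
  rw [integral_fst_mul_eigenfunction] at h2
  unfold freeMeasure at h2
  rw [h2, zero_mul]

/-- Summable weights and bounded intensities allow integration mode by mode; each mode vanishes by
independence of distinct vortices and the zero average of eigenfunctions. -/
lemma integral_hamiltonian_term {m ε K : ℝ} (hm : m < 2) (hε : 0 < ε)
    (hK : ∀ᵐ γ ∂ν, |γ| ≤ K) {N : ℕ} {j k : Fin N} (hjk : j ≠ k) :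
    ∫ ω, (ω j).1 * (ω k).1 * greenReg L m ε (ω j).2 (ω k).2 ∂freeMeasure L ν N = 0 := by
  have hs := (summable_weight hL.out hm hε).mul_left (K * K * 2)
  have h := hasSum_integral_of_dominated_convergence (μ := freeMeasure L ν N)
    (F := fun (n : Freq) ω => weight L m ε n *
      ((ω j).1 * eigenfunction L n (ω j).2 * ((ω k).1 * eigenfunction L n (ω k).2)))
    (f := fun ω => (ω j).1 * (ω k).1 * greenReg L m ε (ω j).2 (ω k).2)
    (fun n _ => K * K * 2 * weight L m ε n)
    (fun n => by
      have := (continuous_eigenfunction L n).measurable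
      apply Measurable.aestronglyMeasurable
      fun_prop)
    (fun n => by
      filter_upwards [ae_forall_eval (ae_abs_fst_le hK) N] with ω hω
      have hw := weight_nonneg hL.out m ε n
      have hK0 : 0 ≤ K := (abs_nonneg _).trans (hω j)
      rw [mul_mul_mul_comm (ω j).1, norm_mul, norm_mul, norm_mul, Real.norm_of_nonneg hw, mul_comm]
      simp only [Real.norm_eq_abs]
      gcongr
      · exact hω j
      · exact hω k
      · exact abs_eigenfunction_mul_le L n _ _)
    (ae_of_all _ fun _ => hs) (integrable_const _)
    (ae_of_all _ fun ω => by
      refine ((hasSum_greenReg hL.out hm hε (ω j).2 (ω k).2).mul_left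
        ((ω j).1 * (ω k).1)).congr_fun fun n => ?_
      ring)
  refine h.unique ?_
  simp only [integral_const_mul, integral_mode_pair _ hjk, mul_zero]
  exact hasSum_zero

lemma integrable_hamiltonian_term {m ε K : ℝ} (hm : m < 2) (hε : 0 < ε)
    (hK : ∀ᵐ γ ∂ν, |γ| ≤ K) {N : ℕ} (j k : Fin N) :
    Integrable (fun ω : Config L N => (ω j).1 * (ω k).1 * greenReg L m ε (ω j).2 (ω k).2)
      (freeMeasure L ν N) := by
  refine .of_bound (measurable_hamiltonian_term hL.out hm hε j k).aestronglyMeasurable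
    (K * K * (2 * ∑' n, weight L m ε n)) ?_
  filter_upwards [ae_forall_eval (ae_abs_fst_le hK) N] with ω hω
  have hK0 : 0 ≤ K := (abs_nonneg _).trans (hω j)
  rw [norm_mul, norm_mul]
  simp only [Real.norm_eq_abs]
  gcongr
  · exact hω j
  · exact hω k
  · exact abs_greenReg_le hL.out hm hε _ _

lemma integrable_hamiltonian {m ε K : ℝ} (hm : m < 2) (hε : 0 < ε)
    (hK : ∀ᵐ γ ∂ν, |γ| ≤ K) (N : ℕ) :
    Integrable (fun ω : Config L N => hamiltonian L m ε ω) (freeMeasure L ν N) :=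
  (integrable_finsetSum _ fun j _ => integrable_finsetSum _ fun k _ =>
    integrable_hamiltonian_term hm hε hK j k).const_mul _

lemma integral_hamiltonian {m ε K : ℝ} (hm : m < 2) (hε : 0 < ε)
    (hK : ∀ᵐ γ ∂ν, |γ| ≤ K) (N : ℕ) :
    ∫ ω : Config L N, hamiltonian L m ε ω ∂freeMeasure L ν N = 0 := by
  unfold hamiltonian
  rw [integral_const_mul, integral_finsetSum _ fun j _ => integrable_finsetSum _ fun k _ =>
    integrable_hamiltonian_term hm hε hK j k, Finset.sum_eq_zero, mul_zero]
  intro j _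
  rw [integral_finsetSum _ fun k _ => integrable_hamiltonian_term hm hε hK j k]
  exact Finset.sum_eq_zero fun k hk =>
    integral_hamiltonian_term hm hε hK (Finset.ne_of_mem_erase hk).symm

/-! ### Partition function and density bound -/

lemma neg_hamiltonian_le {m ε β K : ℝ} (hm : m < 2) (hε : 0 < ε) (hβ : 0 < β) {N : ℕ}
    {ω : Config L N} (hω : ∀ j, |(ω j).1| ≤ K) :
    -(β / N) * hamiltonian L m ε ω ≤ β * (K ^ 2 * ∑' n, weight L m ε n) := by
  have h := hamiltonian_ge hL.out hm hε hω
  have hg : 0 ≤ ∑' n, weight L m ε n := tsum_nonneg fun n => weight_nonneg hL.out m ε n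
  rcases N.eq_zero_or_pos with rfl | hN
  · simp; positivity
  · have hN' : (0 : ℝ) < N := by exact_mod_cast hN
    calc -(β / N) * hamiltonian L m ε ω = β / N * (-hamiltonian L m ε ω) := by ring
      _ ≤ β / N * (N * (K ^ 2 * ∑' n, weight L m ε n)) := by gcongr; linarith
      _ = _ := by field_simp

lemma integrable_exp_neg_hamiltonian {m ε β K : ℝ} (hm : m < 2) (hε : 0 < ε) (hβ : 0 < β)
    (hK : ∀ᵐ γ ∂ν, |γ| ≤ K) (N : ℕ) :
    Integrable (fun ω : Config L N => Real.exp (-(β / N) * hamiltonian L m ε ω))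
      (freeMeasure L ν N) := by
  refine .of_bound (((measurable_hamiltonian hL.out hm hε N).const_mul _).exp).aestronglyMeasurable
    (Real.exp (β * (K ^ 2 * ∑' n, weight L m ε n))) ?_
  filter_upwards [ae_forall_eval (ae_abs_fst_le hK) N] with ω hω
  rw [Real.norm_eq_abs, Real.abs_exp, Real.exp_le_exp]
  exact neg_hamiltonian_le hm hε hβ hω

/-- The partition function is at least `1`, since the Hamiltonian has zero average. -/
lemma one_le_partition {m ε β K : ℝ} (hm : m < 2) (hε : 0 < ε) (hβ : 0 < β)
    (hK : ∀ᵐ γ ∂ν, |γ| ≤ K) (N : ℕ) :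
    1 ≤ ∫ ω : Config L N, Real.exp (-(β / N) * hamiltonian L m ε ω) ∂freeMeasure L ν N := by
  have hi := (integrable_hamiltonian hm hε hK N (L := L)).const_mul (-(β / N))
  calc (1 : ℝ) = ∫ ω : Config L N, (-(β / N) * hamiltonian L m ε ω + 1) ∂freeMeasure L ν N := by
        rw [integral_add hi (integrable_const _), integral_const_mul,
          integral_hamiltonian hm hε hK N]
        simp
    _ ≤ _ := integral_mono (hi.add (integrable_const _))
        (integrable_exp_neg_hamiltonian hm hε hβ hK N) fun ω => Real.add_one_le_exp _

lemma isProbabilityMeasure_gibbs {m ε β K : ℝ} (hm : m < 2) (hε : 0 < ε) (hβ : 0 < β)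
    (hK : ∀ᵐ γ ∂ν, |γ| ≤ K) (N : ℕ) : IsProbabilityMeasure (gibbs L ν m β ε N) :=
  isProbabilityMeasure_tilted (integrable_exp_neg_hamiltonian hm hε hβ hK N)

/-- The numerator of the density is at most the exponential of the self-energy bound, and dividing
by a partition function at least `1` only decreases it. -/
lemma gibbs_le {m ε β K : ℝ} (hm : m < 2) (hε : 0 < ε) (hβ : 0 < β)
    (hK : ∀ᵐ γ ∂ν, |γ| ≤ K) {N : ℕ} (A : Set (Config L N)) :
    gibbs L ν m β ε N A ≤
      ENNReal.ofReal (Real.exp (β * (K ^ 2 * ∑' n, weight L m ε n))) *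
        freeMeasure L ν N A := by
  have hZ := one_le_partition (L := L) hm hε hβ hK N
  have : gibbs L ν m β ε N A = ∫⁻ ω in A, ENNReal.ofReal
      (Real.exp (-(β / N) * hamiltonian L m ε ω) /
        ∫ ω : Config L N, Real.exp (-(β / N) * hamiltonian L m ε ω) ∂freeMeasure L ν N)
      ∂freeMeasure L ν N := tilted_apply (freeMeasure L ν N) _ A
  rw [this, ← setLIntegral_const]
  refine lintegral_mono_ae (ae_restrict_of_ae ?_)
  filter_upwards [ae_forall_eval (ae_abs_fst_le hK) N] with ω hω
  refine ENNReal.ofReal_le_ofReal ((div_le_self (Real.exp_pos _).le hZ).trans ?_)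
  exact Real.exp_le_exp.2 (neg_hamiltonian_le hm hε hβ hω)

/-! ### Concentration under the free and Gibbs measures -/

/-- Hoeffding's inequality for the empirical averages of independent vortices. -/
lemma freeMeasure_sum_ge_le {f : ℝ × Torus L → ℝ} (hf : Measurable f) {M : ℝ}
    (hM : ∀ᵐ p ∂ν.prod (ell L), |f p| ≤ M) {δ : ℝ} (hδ : 0 < δ) (N : ℕ) :
    freeMeasure L ν N {ω | N * δ ≤ ∑ j, (f (ω j) - ∫ p, f p ∂ν.prod (ell L))} ≤
      ENNReal.ofReal (Real.exp (-(N * (δ ^ 2 / (2 * M ^ 2))))) := by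
  have hc := ProbabilityTheory.hasSubgaussianMGF_of_mem_Icc (μ := ν.prod (ell L)) (a := -M) (b := M)
    hf.aemeasurable (hM.mono fun p hp => abs_le.1 hp)
  have hind := ProbabilityTheory.iIndepFun_pi (μ := fun _ : Fin N => ν.prod (ell L))
    (X := fun _ p => f p - ∫ p, f p ∂ν.prod (ell L)) fun _ => (hf.sub_const _).aemeasurable
  have h := ProbabilityTheory.HasSubgaussianMGF.measure_sum_ge_le_of_iIndepFun hind (s := Finset.univ)
    (c := fun _ => (‖M - -M‖₊ / 2) ^ 2) (fun j _ => by
      refine ProbabilityTheory.HasSubgaussianMGF.of_map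
        (measurable_pi_apply j).aemeasurable (X := fun p => f p - ∫ p, f p ∂ν.prod (ell L)) ?_
      rwa [(measurePreserving_eval (fun _ : Fin N => ν.prod (ell L)) j).map_eq])
    (ε := N * δ) (by positivity)
  rw [← ENNReal.ofReal_toReal (measure_ne_top (freeMeasure L ν N) _)]
  refine ENNReal.ofReal_le_ofReal (h.trans (Real.exp_le_exp.2 (le_of_eq ?_)))
  -- The interval `[-M, M]` has half-length `M`, so the variance proxy is `M²`.
  have hn : ((‖M - -M‖₊ / 2 : NNReal) : ℝ) ^ 2 = M ^ 2 := by
    rw [NNReal.coe_div, coe_nnnorm, div_pow, Real.norm_eq_abs, sq_abs]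
    push_cast; ring
  rcases N.eq_zero_or_pos with rfl | hN
  · simp
  have hN' : (N : ℝ) ≠ 0 := by positivity
  simp only [Finset.sum_const, Finset.card_univ, Fintype.card_fin, nsmul_eq_mul]
  rw [NNReal.coe_mul, NNReal.coe_pow, hn, NNReal.coe_natCast]
  -- Division by zero makes both exponents `0` here, leaving the trivial bound `1`.
  by_cases hM0 : M = 0
  · simp [hM0]
  field_simp

lemma freeMeasure_average_le {f : ℝ × Torus L → ℝ} (hf : Measurable f) {M : ℝ}
    (hM : ∀ᵐ p ∂ν.prod (ell L), |f p| ≤ M) {δ : ℝ} (hδ : 0 < δ) {N : ℕ} (hN : 0 < N) :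
    freeMeasure L ν N {ω | δ ≤ |(N : ℝ)⁻¹ * ∑ j, f (ω j) - ∫ p, f p ∂ν.prod (ell L)|} ≤
      2 * ENNReal.ofReal (Real.exp (-(N * (δ ^ 2 / (2 * M ^ 2))))) := by
  have h1 := freeMeasure_sum_ge_le hf hM hδ N
  have h2 := freeMeasure_sum_ge_le hf.neg (by simpa using hM) hδ N
  rw [two_mul]
  refine le_trans ?_ ((measure_union_le _ _).trans (add_le_add h1 h2))
  refine measure_mono fun ω hω => ?_
  have hN' : (0 : ℝ) < N := by exact_mod_cast hN
  simp only [Set.mem_union, Set.mem_ofPred_eq, Pi.neg_apply, integral_neg, Finset.sum_sub_distrib,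
    Finset.sum_neg_distrib, Finset.sum_const, Finset.card_univ, Fintype.card_fin, nsmul_eq_mul]
    at hω ⊢
  have e : (N : ℝ) * ((N : ℝ)⁻¹ * ∑ j, f (ω j) - ∫ p, f p ∂ν.prod (ell L)) =
      ∑ j, f (ω j) - N * ∫ p, f p ∂ν.prod (ell L) := by
    field_simp
  rcases le_abs.1 hω with h | h
  · left
    have := mul_le_mul_of_nonneg_left h hN'.le
    linarith
  · right
    have := mul_le_mul_of_nonneg_left h hN'.le
    linarith

/-- Under the logarithmic lower bound on `ε`, the self-energy is `o(N)`. -/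
lemma tendsto_tsum_weight_div {m : ℝ} (hm : m < 2) {ε : ℕ → ℝ} (hε : ∀ N, 0 < ε N)
    (hlog : ∀ N : ℕ, 2 ≤ N → Real.log N ^ (-(2 / (2 - m))) ≤ ε N) :
    Tendsto (fun N : ℕ => (∑' n, weight L m (ε N) n) / N) atTop (𝓝 0) := by
  set a := 2 - m / 2
  set S := ∑' n : Freq, (eigenvalue L n ^ 2)⁻¹
  have ha : 0 < a := by simp only [a]; linarith
  have hS : 0 ≤ S := tsum_nonneg fun n => by positivity
  have h := ((isLittleO_log_rpow_rpow_atTop (2 / (2 - m) * a) one_pos).tendsto_div_nhds_zero.comp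
    tendsto_natCast_atTop_atTop).const_mul (a ^ a * S)
  rw [mul_zero] at h
  refine squeeze_zero' (Eventually.of_forall fun N => div_nonneg
    (tsum_nonneg fun n => weight_nonneg hL.out m _ n) N.cast_nonneg) ?_ h
  filter_upwards [eventually_ge_atTop 2] with N hN
  have hl : 0 < Real.log N := Real.log_pos (by exact_mod_cast hN)
  have h1 : ε N ^ (-a) ≤ Real.log N ^ (2 / (2 - m) * a) := by
    have := Real.rpow_le_rpow_of_nonpos (by positivity) (hlog N hN) (neg_nonpos.2 ha.le)
    rwa [← Real.rpow_mul hl.le, neg_mul_neg] at this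
  have h2 := tsum_weight_le hL.out hm (hε N)
  simp only [Function.comp_apply, Real.rpow_one]
  rw [← mul_div_assoc]
  gcongr
  calc _ ≤ a ^ a * ε N ^ (-a) * S := h2
    _ ≤ a ^ a * Real.log N ^ (2 / (2 - m) * a) * S := by gcongr
    _ = _ := by ring

/-- The law of large numbers under the Gibbs measures for the empirical average of an essentially
bounded observable. -/
lemma tendsto_gibbs_average {m β K : ℝ} (hm : m < 2) (hβ : 0 < β) (hK : ∀ᵐ γ ∂ν, |γ| ≤ K)
    {ε : ℕ → ℝ} (hε : ∀ N, 0 < ε N)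
    (hlog : ∀ N : ℕ, 2 ≤ N → Real.log N ^ (-(2 / (2 - m))) ≤ ε N)
    {f : ℝ × Torus L → ℝ} (hf : Measurable f) {M : ℝ} (hM0 : 0 < M)
    (hM : ∀ᵐ p ∂ν.prod (ell L), |f p| ≤ M) {δ : ℝ} (hδ : 0 < δ) :
    Tendsto (fun N => gibbs L ν m β (ε N) N
      {ω | δ ≤ |(N : ℝ)⁻¹ * ∑ j, f (ω j) - ∫ p, f p ∂ν.prod (ell L)|}) atTop (𝓝 0) := by
  set c := δ ^ 2 / (2 * M ^ 2)
  have hc : 0 < c := by positivity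
  have hg := ((tendsto_tsum_weight_div (L := L) hm hε hlog).const_mul (β * K ^ 2)).sub_const c
  rw [mul_zero, zero_sub] at hg
  -- The total exponent is `N` times a quantity tending to `-c < 0`.
  have hexp := Real.tendsto_exp_atBot.comp
    (tendsto_natCast_atTop_atTop.atTop_mul_neg (neg_lt_zero.2 hc) hg)
  have h := ENNReal.Tendsto.const_mul (a := 2) (ENNReal.tendsto_ofReal hexp) (by simp)
  rw [ENNReal.ofReal_zero, mul_zero] at h
  refine tendsto_of_tendsto_of_tendsto_of_le_of_le' tendsto_const_nhds h
    (Eventually.of_forall fun _ => zero_le) ?_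
  filter_upwards [eventually_gt_atTop 0] with N hN
  have hN' : (0 : ℝ) < N := by exact_mod_cast hN
  refine (gibbs_le hm (hε N) hβ hK _).trans
    ((mul_le_mul_right (freeMeasure_average_le hf hM hδ hN) _).trans (le_of_eq ?_))
  rw [mul_left_comm, ← ENNReal.ofReal_mul (Real.exp_pos _).le, ← Real.exp_add]
  simp only [Function.comp_apply]
  rw [show δ ^ 2 / (2 * M ^ 2) = c from rfl]
  congr 3
  field_simp
  ring

/-! ### Convergence in probability and weak convergence -/

lemma ConvergesInProbability.of_forall_abs_sub {Ω : ℕ → Type*} {mΩ : ∀ n, MeasurableSpace (Ω n)}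
    {P : ∀ n, Measure (Ω n)} {X : ∀ n, Ω n → ℝ} {a : ℝ}
    (h : ∀ δ > 0, Tendsto (fun n => P n {ω | δ ≤ |X n ω - a|}) atTop (𝓝 0)) :
    ConvergesInProbability P X a := by
  intro U hU
  obtain ⟨δ, hδ, hU⟩ := Metric.mem_nhds_iff.1 hU
  refine tendsto_of_tendsto_of_tendsto_of_le_of_le tendsto_const_nhds (h δ hδ)
    (fun _ => zero_le) fun n => measure_mono fun ω hω => ?_
  by_contra hlt
  exact hω (hU (by simpa [Real.dist_eq] using hlt))

/-- The sets to which `X n` belongs with probability tending to `1`. -/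
def filterInProbability {Ω : ℕ → Type*} {mΩ : ∀ n, MeasurableSpace (Ω n)}
    (P : ∀ n, Measure (Ω n)) {E : Type*} (X : ∀ n, Ω n → E) : Filter E where
  sets := {U | Tendsto (fun n => P n {ω | X n ω ∉ U}) atTop (𝓝 0)}
  univ_sets := by simp
  sets_of_superset {U V} hU hUV :=
    tendsto_of_tendsto_of_tendsto_of_le_of_le tendsto_const_nhds hU (fun _ => zero_le)
      fun n => measure_mono fun ω hω h => hω (hUV h)
  inter_sets {U V} hU hV := by
    have h := hU.add hV
    rw [add_zero] at h
    refine tendsto_of_tendsto_of_tendsto_of_le_of_le tendsto_const_nhds h (fun _ => zero_le)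
      fun n => le_trans (measure_mono fun ω hω => ?_) (measure_union_le _ _)
    simpa [imp_iff_not_or] using hω

lemma convergesInProbability_iff {Ω : ℕ → Type*} {mΩ : ∀ n, MeasurableSpace (Ω n)}
    {P : ∀ n, Measure (Ω n)} {E : Type*} [TopologicalSpace E] {X : ∀ n, Ω n → E} {a : E} :
    ConvergesInProbability P X a ↔ filterInProbability P X ≤ 𝓝 a :=
  Iff.rfl

/-- Random probability measures converge weakly in probability as soon as their integrals against
bounded continuous functions do. -/
lemma ConvergesInProbability.of_forall_integral {Ω : ℕ → Type*}
    {mΩ : ∀ n, MeasurableSpace (Ω n)} {P : ∀ n, Measure (Ω n)} {E : Type*} [TopologicalSpace E]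
    [MeasurableSpace E] [OpensMeasurableSpace E] {X : ∀ n, Ω n → ProbabilityMeasure E}
    {μ : ProbabilityMeasure E}
    (h : ∀ f : BoundedContinuousFunction E ℝ,
      ConvergesInProbability P (fun n ω => ∫ x, f x ∂(X n ω : Measure E)) (∫ x, f x ∂(μ : Measure E))) :
    ConvergesInProbability P X μ := by
  rw [convergesInProbability_iff]
  -- The test-function criterion holds along any filter; it is applied to the identity map along
  -- `filterInProbability`.
  exact (ProbabilityMeasure.tendsto_iff_forall_integral_tendsto (μs := fun η => η)
    (F := filterInProbability P X)).2 fun f V hV => h f V hV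

lemma integral_empiricalMeasure {N : ℕ} [NeZero N] (ω : Config L N)
    (f : BoundedContinuousFunction (ℝ × Torus L) ℝ) :
    ∫ p, f p ∂(empiricalMeasure ω : Measure (ℝ × Torus L)) = (N : ℝ)⁻¹ * ∑ j, f (ω j) := by
  change ∫ p, f p ∂((N : ℝ≥0∞)⁻¹ • ∑ j, Measure.dirac (ω j)) = _
  rw [integral_smul_measure, integral_finsetSum_measure fun j _ => f.integrable _]
  simp

lemma integral_pseudoVorticity {N : ℕ} (ω : Config L N) (φ : C(Torus L, ℝ)) :
    VectorMeasure.integral (pseudoVorticity ω) φ (ContinuousLinearMap.lsmul ℝ ℝ).flip =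
      (N : ℝ)⁻¹ * ∑ j, (ω j).1 * φ (ω j).2 := by
  obtain ⟨M, hM⟩ := isCompact_univ.exists_bound_of_continuousOn φ.continuous.continuousOn
  rw [pseudoVorticity, VectorMeasure.integral_smul_vectorMeasure,
    VectorMeasure.integral_finsetSum_vectorMeasure fun j _ =>
      .of_bound φ.continuous.aestronglyMeasurable M (ae_of_all _ fun x => hM x trivial)]
  simp [VectorMeasure.integral_dirac]

end

end PointVortex

open PointVortex in
theorem theorem3p2 (L : ℝ) [Fact (0 < L)] (ν : Measure ℝ) [IsProbabilityMeasure ν]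
    (hν : ∃ K : Set ℝ, IsCompact K ∧ ν Kᶜ = 0) (β : ℝ) (hβ : 0 < β) :
    ∃ C : ℝ, 0 < C ∧ ∀ m : ℝ, m < 2 → ∀ ε : ℕ → ℝ,
      (∀ N, 0 < ε N) → Tendsto ε atTop (𝓝 0) →
      (∀ N : ℕ, 2 ≤ N → C * Real.log N ^ (-(2 / (2 - m))) ≤ ε N) →
      (∀ N : ℕ, IsProbabilityMeasure (gibbs L ν m β (ε N) N)) ∧
      -- the sequences are indexed by `n` with `N = n + 1` vortices
      ConvergesInProbability (fun n : ℕ => gibbs L ν m β (ε (n + 1)) (n + 1))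
        (fun _ ω => empiricalMeasure ω) (limitMeasure L ν) ∧
      ∀ φ : C(Torus L, ℝ),
        ConvergesInProbability (fun n : ℕ => gibbs L ν m β (ε (n + 1)) (n + 1))
          (fun _ ω => VectorMeasure.integral (pseudoVorticity ω) φ
            (ContinuousLinearMap.lsmul ℝ ℝ).flip)
          ((∫ γ, γ ∂ν) * ∫ x, φ x ∂(ell L)) := by
  obtain ⟨S, hS, hS0⟩ := hν
  obtain ⟨K, hK0, hSK⟩ := hS.isBounded.exists_pos_norm_le
  have hK : ∀ᵐ γ ∂ν, |γ| ≤ K := by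
    have : ∀ᵐ γ ∂ν, γ ∈ S := hS0
    exact this.mono fun γ hγ => hSK γ hγ
  -- Any positive constant would serve: it only rescales a power of `log N`, which stays `o(N)`.
  refine ⟨1, one_pos, fun m hm ε hε _ hlog => ?_⟩
  simp only [one_mul] at hlog
  refine ⟨fun N => isProbabilityMeasure_gibbs hm (hε N) hβ hK N, ?_, fun φ => ?_⟩
  · refine .of_forall_integral fun f => .of_forall_abs_sub fun δ hδ => ?_
    simp only [integral_empiricalMeasure]
    exact (tendsto_gibbs_average hm hβ hK hε hlog f.continuous.measurable (M := ‖f‖ + 1)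
      (by positivity) (ae_of_all _ fun p => (f.norm_coe_le_norm p).trans (by linarith)) hδ).comp
      (tendsto_add_atTop_nat 1)
  · refine .of_forall_abs_sub fun δ hδ => ?_
    simp only [integral_pseudoVorticity]
    obtain ⟨M, hM⟩ := isCompact_univ.exists_bound_of_continuousOn φ.continuous.continuousOn
    have hM' (x : Torus L) : |φ x| ≤ |M| + 1 :=
      (hM x trivial).trans ((le_abs_self M).trans (by linarith))
    -- The observable `γ φ(x)` need not be bounded on `ℝ × Torus L`, so weak convergence does not
    -- apply directly; it is essentially bounded, which suffices for the concentration estimate.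
    have := (tendsto_gibbs_average hm hβ hK hε hlog (f := fun p => p.1 * φ p.2)
      (by have := φ.continuous.measurable; fun_prop) (M := K * (|M| + 1)) (by positivity)
      ((ae_abs_fst_le hK).mono fun p hp => by
        rw [abs_mul]; gcongr; exact hM' p.2) hδ).comp (tendsto_add_atTop_nat 1)
    rwa [integral_prod_mul (fun γ : ℝ => γ) φ] at this
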